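/- Let $\mathbb D=\{z\in\mathbb C : |z|<1\}$ and $\Pi^+=\{z\in\mathbb C : \operatorname{Re} z>0\}$. For $\alpha>-1$ let $\mathcal A_\alpha$ be the weighted area measure on $\mathbb D$ given by $$d\mathcal A_\alpha(z)=(\alpha+1)\,(1-|z|^2)^\alpha\,\frac{dx\,dy}{\pi},\qquad z=x+iy .$$ Theorem. For every real $\alpha>-1$ there exist constants $K_0>0$, $c_0>0$ and $\lambda_0>1$ (depending only on $\alpha$) such that every analytic function $g\colon\mathbb D\to\Pi^+$ with $|g(0)|\le c_0$ satisfies, for every $\lambda\ge\lambda_0$, $$\mathcal A_\alpha\big(\{z\in\mathbb D : |g(z)|>\lambda\}\big)\le\frac{K_0}{\lambda^{\alpha+2}}\,\mathcal A_\alpha\big(\{z\in\mathbb D : |g(z)|>1\}\big).$$ -/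

import Mathlib

open MeasureTheory

namespace WeightedBergman

noncomputable section

/-- The open unit disk `𝔻` of the complex plane. -/
def disk : Set ℂ := {z | ‖z‖ < 1}

/-- The open right half-plane `Π⁺`. -/
def rightHalfPlane : Set ℂ := {z | 0 < z.re}

/-- The normalized area measure `dx dy / π` on the unit disk, as a measure on `ℂ` carried
by the disk. -/
def area : Measure ℂ := (ENNReal.ofReal Real.pi)⁻¹ • volume.restrict disk

/-- The weighted area measure `(α + 1) (1 - |z|²)^α dx dy / π` on the unit disk, as a measure
on `ℂ` carried by the disk. -/
def weightedArea (α : ℝ) : Measure ℂ :=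
  area.withDensity fun z => ENNReal.ofReal ((α + 1) * (1 - ‖z‖ ^ 2) ^ α)

end

end WeightedBergman

/-!
Write `δ(w) = 1 - ‖w‖ ^ 2`, and call `z` near `w` if `‖z - w‖ ≤ 2 δ(w)`. The constant `c₀ = 1` works.

*Local estimate.* Let `‖g w‖ ≤ 25` and let `l` be large. By the Schwarz–Pick lemma, in the form of a
Harnack inequality for `‖g‖` (`norm_mul_one_sub_norm_sq_le_of_near`), the points `z` near `w` with
`l < ‖g z‖` lie in an annulus `δ(z) = O(δ(w) / l)`. On each circle in that annulus they have angular
measure `O(δ(w) / l)`: this is a weak-type estimate for the positive harmonic function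
`Re (g / (g + l))`, localized by the Poisson kernel at `w` (`volume_arc_le`). Integration in polar
coordinates bounds their weighted area by a multiple of `(δ(w) / l) ^ (α + 2)`
(`setLIntegral_density_near_le`).

*Globalization.* If `‖g 0‖ ≤ 1` and `l < ‖g z‖`, then `‖g‖ = 10` at some point of the radius through
`z`, and by the Harnack inequality `1 < ‖g‖ < 25` on a whole hyperbolic ball around it, all of whose
points have `z` near them. So `z` is near the points of a subset of `W = {1 < ‖g‖ < 25}` whose
measure with respect to `δ(w) ^ (-2) dx dy` is bounded below (`le_setLIntegral_near`). By Tonelli's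
theorem the weighted area of `{l < ‖g‖}` is at most a multiple of the integral of
`δ(w) ^ (-2) * (δ(w) / l) ^ (α + 2) = l ^ (-(α + 2)) * δ(w) ^ α` over `W`, which is a multiple of
`l ^ (-(α + 2))` times the weighted area of `W`.
-/

namespace WeightedBergman

/-! ### Harnack inequalities for maps into the right half-plane -/

/-- The Cayley transform `w ↦ (w - a) / (w + conj a)` maps the right half-plane into the closed
unit disk. -/
theorem norm_sub_le_norm_add_conj {a w : ℂ} (ha : 0 < a.re) (hw : 0 < w.re) :
    ‖w - a‖ ≤ ‖w + (starRingEnd ℂ) a‖ := by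
  rw [← sq_le_sq₀ (norm_nonneg _) (norm_nonneg _), Complex.sq_norm, Complex.sq_norm,
    Complex.normSq_apply, Complex.normSq_apply]
  simp only [Complex.sub_re, Complex.sub_im, Complex.add_re, Complex.add_im, Complex.conj_re,
    Complex.conj_im]
  nlinarith [mul_pos ha hw]

/-- Two-sided Harnack inequality for the modulus of an analytic map into the right half-plane: the
Schwarz lemma for `(g - g c) / (g + conj (g c))`. -/
theorem harnack_of_mapsTo_rightHalfPlane {g : ℂ → ℂ} {c z : ℂ} {R : ℝ}
    (hd : DifferentiableOn ℂ g (Metric.ball c R))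
    (hmaps : Set.MapsTo g (Metric.ball c R) rightHalfPlane) (hz : z ∈ Metric.ball c R) :
    ‖g z‖ * (R - dist z c) ≤ ‖g c‖ * (R + dist z c) ∧
      ‖g c‖ * (R - dist z c) ≤ ‖g z‖ * (R + dist z c) := by
  have hR : 0 < R := dist_nonneg.trans_lt (Metric.mem_ball.1 hz)
  have hc : 0 < (g c).re := hmaps (Metric.mem_ball_self hR)
  have hne : ∀ x ∈ Metric.ball c R, g x + (starRingEnd ℂ) (g c) ≠ 0 := by
    intro x hx h
    have h1 : 0 < (g x).re := hmaps hx
    have h2 := congrArg Complex.re h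
    simp only [Complex.add_re, Complex.conj_re, Complex.zero_re] at h2
    linarith
  have key := Complex.dist_le_div_mul_dist_of_mapsTo_ball (R₂ := 1)
    (f := fun x => (g x - g c) / (g x + (starRingEnd ℂ) (g c)))
    ((hd.sub_const _).div (hd.add_const _) hne) (fun x hx => by
      have h1 : 0 < (g x).re := hmaps hx
      simpa using div_le_one_of_le₀ (norm_sub_le_norm_add_conj hc h1) (norm_nonneg _)) hz
  simp only [sub_self, zero_div, dist_zero_right, norm_div] at key
  have hpos : 0 < ‖g z + (starRingEnd ℂ) (g c)‖ := norm_pos_iff.2 (hne z hz)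
  rw [div_mul_eq_mul_div, one_mul, div_le_div_iff₀ hpos hR] at key
  have h1 : ‖g z + (starRingEnd ℂ) (g c)‖ ≤ ‖g z‖ + ‖g c‖ := by
    simpa using norm_add_le (g z) ((starRingEnd ℂ) (g c))
  have h2 := mul_le_mul_of_nonneg_left h1 (dist_nonneg (x := z) (y := c))
  have h3 := mul_le_mul_of_nonneg_right (norm_sub_norm_le (g z) (g c)) hR.le
  have h4 := mul_le_mul_of_nonneg_right (norm_sub_norm_le (g c) (g z)) hR.le
  rw [norm_sub_rev] at h4
  constructor <;> nlinarith

theorem disk_eq_ball : disk = Metric.ball 0 1 := by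
  ext z; simp [disk]

theorem norm_one_sub_conj_mul_sq_sub (w z : ℂ) :
    ‖1 - (starRingEnd ℂ) w * z‖ ^ 2 - ‖z - w‖ ^ 2 = (1 - ‖w‖ ^ 2) * (1 - ‖z‖ ^ 2) := by
  simp only [Complex.sq_norm, Complex.normSq_apply, Complex.sub_re, Complex.sub_im, Complex.mul_re,
    Complex.mul_im, Complex.one_re, Complex.one_im, Complex.conj_re, Complex.conj_im]
  ring

theorem one_sub_norm_sq_pos {z : ℂ} (hz : z ∈ disk) : 0 < 1 - ‖z‖ ^ 2 := by
  have h : ‖z‖ < 1 := hz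
  nlinarith [norm_nonneg z]

theorem one_add_conj_mul_ne_zero {w u : ℂ} (hw : w ∈ disk) (hu : u ∈ disk) :
    1 + (starRingEnd ℂ) w * u ≠ 0 := by
  intro h
  have h1 : ‖(starRingEnd ℂ) w * u‖ = 1 := by
    rw [eq_neg_of_add_eq_zero_right h]; simp
  rw [norm_mul, RCLike.norm_conj] at h1
  have hw' : ‖w‖ < 1 := hw
  have hu' : ‖u‖ < 1 := hu
  nlinarith [norm_nonneg w, norm_nonneg u]

/-- The Harnack inequality between two arbitrary points of the disk. With
`ρ = ‖z - w‖ / ‖1 - conj w * z‖` the pseudo-hyperbolic distance, it reads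
`‖g z‖ ≤ (1 + ρ) / (1 - ρ) * ‖g w‖ ≤ 4 / (1 - ρ ^ 2) * ‖g w‖`. -/
theorem norm_mul_one_sub_norm_sq_le {g : ℂ → ℂ} (hg : DifferentiableOn ℂ g disk)
    (hmaps : Set.MapsTo g disk rightHalfPlane) {w z : ℂ} (hw : w ∈ disk) (hz : z ∈ disk) :
    ‖g z‖ * ((1 - ‖w‖ ^ 2) * (1 - ‖z‖ ^ 2)) ≤ 4 * ‖1 - (starRingEnd ℂ) w * z‖ ^ 2 * ‖g w‖ := by
  -- The disk automorphism `m` sends `0` to `w` and `u` to `z`, which reduces to the centered case.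
  set m : ℂ → ℂ := fun u => (u + w) / (1 + (starRingEnd ℂ) w * u) with hm
  have hwδ := one_sub_norm_sq_pos hw
  have hzδ := one_sub_norm_sq_pos hz
  have hmm : Set.MapsTo m (Metric.ball 0 1) disk := by
    intro u hu
    rw [← disk_eq_ball] at hu
    have h0 := one_add_conj_mul_ne_zero hw hu
    have h1 := norm_one_sub_conj_mul_sq_sub (-w) u
    have hpos := mul_pos hwδ (one_sub_norm_sq_pos hu)
    simp only [map_neg, neg_mul, sub_neg_eq_add, norm_neg] at h1
    change ‖(u + w) / (1 + (starRingEnd ℂ) w * u)‖ < 1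
    rw [norm_div, div_lt_one (norm_pos_iff.2 h0)]
    refine lt_of_pow_lt_pow_left₀ 2 (norm_nonneg _) ?_
    linarith
  have hmd : DifferentiableOn ℂ m (Metric.ball 0 1) := by
    refine DifferentiableOn.div (by fun_prop) (by fun_prop) fun u hu => ?_
    exact one_add_conj_mul_ne_zero hw (disk_eq_ball ▸ hu)
  set a := ‖z - w‖ with ha
  set b := ‖1 - (starRingEnd ℂ) w * z‖ with hb
  have hab : b ^ 2 - a ^ 2 = (1 - ‖w‖ ^ 2) * (1 - ‖z‖ ^ 2) := norm_one_sub_conj_mul_sq_sub w z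
  have hpos := mul_pos hwδ hzδ
  have ha0 : 0 ≤ a := norm_nonneg _
  have hb0 : 0 ≤ b := norm_nonneg _
  have hlt : a < b := lt_of_pow_lt_pow_left₀ 2 hb0 (by linarith)
  have hbpos : 0 < b := ha0.trans_lt hlt
  have hbne : 1 - (starRingEnd ℂ) w * z ≠ 0 := norm_pos_iff.1 hbpos
  set u : ℂ := (z - w) / (1 - (starRingEnd ℂ) w * z) with hu
  have hun : ‖u‖ = a / b := by rw [hu, norm_div]
  have hub : u ∈ Metric.ball (0 : ℂ) 1 := by
    rw [mem_ball_zero_iff, hun, div_lt_one hbpos]; exact hlt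
  have hmu : m u = z := by
    have h0 := one_add_conj_mul_ne_zero hw (disk_eq_ball ▸ hub)
    simp only [hm]
    have h1 : u * (1 - (starRingEnd ℂ) w * z) = z - w := div_mul_cancel₀ _ hbne
    rw [div_eq_iff h0]
    linear_combination h1
  have hm0 : m 0 = w := by simp [hm]
  have key := (harnack_of_mapsTo_rightHalfPlane (g := g ∘ m) (hg.comp hmd hmm) (hmaps.comp hmm)
    hub).1
  simp only [Function.comp, hmu, hm0, dist_zero_right, hun] at key
  have key2 : ‖g z‖ * (b - a) ≤ ‖g w‖ * (b + a) := by
    have := mul_le_mul_of_nonneg_right key hbpos.le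
    have e1 : ‖g z‖ * (1 - a / b) * b = ‖g z‖ * (b - a) := by field_simp
    have e2 : ‖g w‖ * (1 + a / b) * b = ‖g w‖ * (b + a) := by field_simp
    linarith
  calc ‖g z‖ * ((1 - ‖w‖ ^ 2) * (1 - ‖z‖ ^ 2)) = ‖g z‖ * (b - a) * (b + a) := by rw [← hab]; ring
    _ ≤ ‖g w‖ * (b + a) * (b + a) := by gcongr
    _ ≤ ‖g w‖ * (b + b) * (b + b) := by gcongr
    _ = 4 * b ^ 2 * ‖g w‖ := by ring

/-- Near `w`, at the scale `1 - ‖w‖ ^ 2`, the modulus of `g` at `z` is controlled by its modulus at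
`w` and the ratio of the distances to the circle. Hence `g` can be large near `w` only very close to
the circle. -/
theorem norm_mul_one_sub_norm_sq_le_of_near {g : ℂ → ℂ} (hg : DifferentiableOn ℂ g disk)
    (hmaps : Set.MapsTo g disk rightHalfPlane) {w z : ℂ} (hw : w ∈ disk) (hz : z ∈ disk)
    (hzw : ‖z - w‖ ≤ 2 * (1 - ‖w‖ ^ 2)) :
    ‖g z‖ * (1 - ‖z‖ ^ 2) ≤ 36 * ‖g w‖ * (1 - ‖w‖ ^ 2) := by
  have hwδ := one_sub_norm_sq_pos hw
  have hw1 : ‖w‖ ≤ 1 := le_of_lt hw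
  have hb : ‖1 - (starRingEnd ℂ) w * z‖ ≤ 3 * (1 - ‖w‖ ^ 2) := by
    -- `1 - conj w * z = (1 - ‖w‖ ^ 2) - conj w * (z - w)`, and both terms are `O(1 - ‖w‖ ^ 2)`.
    have e : 1 - (starRingEnd ℂ) w * z =
        ((1 - ‖w‖ ^ 2 : ℝ) : ℂ) - (starRingEnd ℂ) w * (z - w) := by
      rw [mul_sub, Complex.conj_mul' w]; push_cast; ring
    rw [e]
    calc _ ≤ ‖((1 - ‖w‖ ^ 2 : ℝ) : ℂ)‖ + ‖(starRingEnd ℂ) w * (z - w)‖ := norm_sub_le _ _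
      _ = (1 - ‖w‖ ^ 2) + ‖w‖ * ‖z - w‖ := by
        rw [norm_mul, RCLike.norm_conj, Complex.norm_real, Real.norm_of_nonneg hwδ.le]
      _ ≤ _ := by nlinarith [norm_nonneg (z - w), norm_nonneg w]
  have h1 := norm_mul_one_sub_norm_sq_le hg hmaps hw hz
  have h2 : ‖1 - (starRingEnd ℂ) w * z‖ ^ 2 ≤ (3 * (1 - ‖w‖ ^ 2)) ^ 2 := by gcongr
  have h3 := mul_le_mul_of_nonneg_right h2 (norm_nonneg (g w))
  refine le_of_mul_le_mul_right ?_ hwδ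
  nlinarith

/-! ### Weak-type estimate on circles -/

/-- The positive harmonic function `w ↦ Re (w / (w + l))` on the right half-plane detects the region
`l ≤ ‖w‖`: it is at least `1 / 2` there. -/
theorem half_le_re_div_add {l : ℝ} {w : ℂ} (hl : 0 < l) (hw : 0 < w.re) (hlw : l ≤ ‖w‖) :
    1 / 2 ≤ (w / (w + l)).re := by
  have h1 : l ^ 2 ≤ w.re ^ 2 + w.im ^ 2 := by
    have := pow_le_pow_left₀ hl.le hlw 2
    rw [Complex.sq_norm, Complex.normSq_apply] at this
    nlinarith
  have hpos : 0 < (w.re + l) ^ 2 + w.im ^ 2 := by positivity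
  rw [Complex.div_re, Complex.normSq_apply]
  simp only [Complex.add_re, Complex.ofReal_re, Complex.add_im, Complex.ofReal_im, add_zero]
  rw [← add_div, div_le_div_iff₀ two_pos (by nlinarith)]
  nlinarith

theorem re_div_add_nonneg {l : ℝ} {w : ℂ} (hl : 0 < l) (hw : 0 < w.re) :
    0 ≤ (w / (w + l)).re := by
  rw [Complex.div_re, Complex.normSq_apply]
  simp only [Complex.add_re, Complex.ofReal_re, Complex.add_im, Complex.ofReal_im, add_zero]
  have := mul_self_nonneg w.im
  positivity

theorem re_div_add_le {l : ℝ} {w : ℂ} (hl : 0 < l) (hw : 0 < w.re) :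
    (w / (w + l)).re ≤ ‖w‖ / l := by
  refine (Complex.re_le_norm _).trans ?_
  rw [norm_div]
  gcongr
  calc l ≤ (w + l).re := by simp [hw.le]
    _ ≤ _ := Complex.re_le_norm _

/-- Weak-type estimate on a circle of radius `r` close to `1`: among the points near `w` on that
circle, those with `l < ‖g‖` occupy an arc measure `O(‖g w‖ * (1 - ‖w‖ ^ 2) / l)`. The Poisson kernel
at `w` is at least of order `(1 - ‖w‖ ^ 2)⁻¹` at these points and `Re (g / (g + l))` is at least
`1 / 2`, while the Poisson integral of the latter is its value at `w`, at most `‖g w‖ / l`. -/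
theorem volume_arc_le {g : ℂ → ℂ} (hg : AnalyticOnNhd ℂ g disk)
    (hmaps : Set.MapsTo g disk rightHalfPlane) {w : ℂ} (hw : w ∈ disk) {l r : ℝ} (hl : 0 < l)
    (hr : 0 < r) (hr1 : r < 1) (hwr : 1 - r ^ 2 ≤ (1 - ‖w‖ ^ 2) / 2) :
    volume (Set.Ioo (-Real.pi) Real.pi ∩ {θ : ℝ | ‖circleMap 0 r θ - w‖ ≤ 2 * (1 - ‖w‖ ^ 2) ∧
        l < ‖g (circleMap 0 r θ)‖}) ≤
      ENNReal.ofReal (32 * Real.pi * ‖g w‖ * (1 - ‖w‖ ^ 2) / l) := by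
  have hwδ := one_sub_norm_sq_pos hw
  have hwr' : ‖w‖ < r := lt_of_pow_lt_pow_left₀ 2 hr.le (by linarith)
  have hsub : Metric.closedBall (0 : ℂ) r ⊆ disk := by
    rw [disk_eq_ball]; exact Metric.closedBall_subset_ball hr1
  have hne : ∀ z ∈ disk, g z + l ≠ 0 := by
    intro z hz h
    have h1 : 0 < (g z).re := hmaps hz
    have h2 := congrArg Complex.re h
    simp only [Complex.add_re, Complex.ofReal_re, Complex.zero_re] at h2
    linarith
  set h : ℂ → ℝ := fun z => (g z / (g z + l)).re with hh
  have harm : InnerProductSpace.HarmonicOnNhd h (Metric.closedBall 0 r) := fun z hz =>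
    ((hg z (hsub hz)).div ((hg z (hsub hz)).add analyticAt_const) (hne z (hsub hz))).harmonicAt_re
  have hpoisson := harm.circleAverage_poissonKernel_smul (w := w) (by simpa using hwr')
  rw [Real.circleAverage_eq_integral_add (-Real.pi),
    intervalIntegral.integral_comp_add_right
      (fun θ => (poissonKernel 0 w • h) (circleMap 0 r θ)),
    zero_add, show 2 * Real.pi + -Real.pi = Real.pi by ring, smul_eq_mul,
    inv_mul_eq_iff_eq_mul₀ (by positivity)] at hpoisson
  have hcirc : ∀ θ : ℝ, circleMap 0 r θ ∈ disk := fun θ =>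
    hsub (circleMap_mem_closedBall _ hr.le θ)
  set F : ℝ → ℝ := fun θ => (poissonKernel 0 w • h) (circleMap 0 r θ) with hF
  have hFeq : ∀ θ, F θ = (r ^ 2 - ‖w‖ ^ 2) / ‖circleMap 0 r θ - w‖ ^ 2 * h (circleMap 0 r θ) := by
    intro θ
    simp [hF, poissonKernel_def, abs_of_pos hr]
  have hdist : ∀ θ, 0 < ‖circleMap 0 r θ - w‖ := by
    intro θ
    rw [norm_pos_iff, sub_ne_zero]
    intro e
    have : ‖circleMap 0 r θ‖ = r := by simp [abs_of_pos hr]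
    rw [e] at this; linarith
  have hnum : (1 - ‖w‖ ^ 2) / 2 ≤ r ^ 2 - ‖w‖ ^ 2 := by linarith
  have hFcont : Continuous F := by
    have e : F = fun θ => (r ^ 2 - ‖w‖ ^ 2) / ‖circleMap 0 r θ - w‖ ^ 2 * h (circleMap 0 r θ) :=
      funext hFeq
    rw [e]
    have hc : Continuous (circleMap 0 r) := continuous_circleMap 0 r
    refine (continuous_const.div (by fun_prop) fun θ => (pow_pos (hdist θ) 2).ne').mul ?_
    exact harm.continuousOn.comp_continuous hc fun θ => circleMap_mem_closedBall _ hr.le θ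
  have hF0 : ∀ θ, 0 ≤ F θ := by
    intro θ
    rw [hFeq]
    have := re_div_add_nonneg hl (hmaps (hcirc θ))
    have : 0 ≤ r ^ 2 - ‖w‖ ^ 2 := by linarith
    positivity
  have hint : ∫ θ in Set.Ioc (-Real.pi) Real.pi, F θ ≤ 2 * Real.pi * (‖g w‖ / l) := by
    rw [← intervalIntegral.integral_of_le (by linarith [Real.pi_pos]), hpoisson]
    gcongr
    exact re_div_add_le hl (hmaps hw)
  have hFint : Integrable F (volume.restrict (Set.Ioc (-Real.pi) Real.pi)) :=
    hFcont.integrableOn_Ioc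
  -- On the set to be measured, the kernel is at least `1 / (8 * (1 - ‖w‖ ^ 2))` and `h ≥ 1 / 2`.
  have hmarkov := mul_meas_ge_le_integral_of_nonneg (Filter.Eventually.of_forall hF0) hFint
    (1 / (16 * (1 - ‖w‖ ^ 2)))
  have hset : Set.Ioo (-Real.pi) Real.pi ∩ {θ : ℝ | ‖circleMap 0 r θ - w‖ ≤ 2 * (1 - ‖w‖ ^ 2) ∧
        l < ‖g (circleMap 0 r θ)‖} ⊆
      {θ | 1 / (16 * (1 - ‖w‖ ^ 2)) ≤ F θ} ∩ Set.Ioc (-Real.pi) Real.pi := by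
    rintro θ ⟨hθ, hθ1, hθ2⟩
    refine ⟨?_, Set.Ioo_subset_Ioc_self hθ⟩
    have h1 : 1 / 2 ≤ h (circleMap 0 r θ) := half_le_re_div_add hl (hmaps (hcirc θ)) hθ2.le
    have h2 : ‖circleMap 0 r θ - w‖ ^ 2 ≤ (2 * (1 - ‖w‖ ^ 2)) ^ 2 :=
      pow_le_pow_left₀ (norm_nonneg _) hθ1 2
    change _ ≤ F θ
    rw [hFeq]
    calc 1 / (16 * (1 - ‖w‖ ^ 2))
        = ((1 - ‖w‖ ^ 2) / 2) / (2 * (1 - ‖w‖ ^ 2)) ^ 2 * (1 / 2) := by field_simp; norm_num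
      _ ≤ _ := by
        have h3 := pow_pos (hdist θ) 2
        have h4 : 0 ≤ r ^ 2 - ‖w‖ ^ 2 := by linarith
        have h5 : 0 ≤ (r ^ 2 - ‖w‖ ^ 2) / ‖circleMap 0 r θ - w‖ ^ 2 := div_nonneg h4 h3.le
        gcongr
  have hvol : (volume.restrict (Set.Ioc (-Real.pi) Real.pi)).real
      {θ | 1 / (16 * (1 - ‖w‖ ^ 2)) ≤ F θ} ≤ 32 * Real.pi * ‖g w‖ * (1 - ‖w‖ ^ 2) / l := by
    have h3 := hmarkov.trans hint
    rw [div_mul_eq_mul_div, one_mul, div_le_iff₀ (by positivity)] at h3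
    refine h3.trans (le_of_eq ?_)
    ring
  calc _ ≤ volume ({θ | 1 / (16 * (1 - ‖w‖ ^ 2)) ≤ F θ} ∩ Set.Ioc (-Real.pi) Real.pi) :=
        measure_mono hset
    _ = (volume.restrict (Set.Ioc (-Real.pi) Real.pi)) {θ | 1 / (16 * (1 - ‖w‖ ^ 2)) ≤ F θ} := by
        rw [Measure.restrict_apply' measurableSet_Ioc]
    _ = ENNReal.ofReal ((volume.restrict (Set.Ioc (-Real.pi) Real.pi)).real
          {θ | 1 / (16 * (1 - ‖w‖ ^ 2)) ≤ F θ}) := by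
        rw [ofReal_measureReal]
    _ ≤ _ := ENNReal.ofReal_le_ofReal hvol

/-! ### Integration in polar coordinates -/

/-- The density of `weightedArea α` with respect to `dx dy / π` on the disk, defined on all of `ℂ`
by the same formula. -/
noncomputable def density (α : ℝ) (z : ℂ) : ENNReal := ENNReal.ofReal ((α + 1) * (1 - ‖z‖ ^ 2) ^ α)

theorem measurable_density (α : ℝ) : Measurable (density α) := by
  unfold density; fun_prop

/-- The lower limit `√(1 - ε)` is the radius at which `1 - r ^ 2 = ε`. For `α < 0` the integrand is
unbounded at `r = 1`. -/
theorem lintegral_radial_density {α ε : ℝ} (hα : -1 < α) (hε : 0 ≤ ε) (hε1 : ε ≤ 1) :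
    ∫⁻ r in Set.Ioo (√(1 - ε)) 1, ENNReal.ofReal (r * ((α + 1) * (1 - r ^ 2) ^ α)) =
      ENNReal.ofReal (ε ^ (α + 1) / 2) := by
  set a := √(1 - ε) with ha
  have ha0 : 0 ≤ a := Real.sqrt_nonneg _
  have ha2 : a ^ 2 = 1 - ε := Real.sq_sqrt (by linarith)
  have ha1 : a ≤ 1 := by rw [ha]; exact Real.sqrt_le_one.2 (by linarith)
  have hα1 : 0 < α + 1 := by linarith
  set G : ℝ → ℝ := fun r => -((1 - r ^ 2) ^ (α + 1) / 2) with hG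
  have hcont : ContinuousOn G (Set.Icc a 1) := by
    refine (ContinuousOn.div_const ?_ _).neg
    exact ContinuousOn.rpow_const (by fun_prop) fun _ _ => Or.inr hα1.le
  have hpos : ∀ r ∈ Set.Ioo a 1, 0 < 1 - r ^ 2 := fun r hr => by nlinarith [hr.1, hr.2]
  have hderiv : ∀ r ∈ Set.Ioo a 1, HasDerivAt G (r * ((α + 1) * (1 - r ^ 2) ^ α)) r := by
    intro r hr
    have h1 : HasDerivAt (fun r : ℝ => 1 - r ^ 2) (-(2 * r)) r := by
      simpa using (hasDerivAt_pow 2 r).const_sub 1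
    have h2 := ((h1.rpow_const (p := α + 1) (Or.inl (hpos r hr).ne')).div_const 2).neg
    refine h2.congr_deriv ?_
    rw [add_sub_cancel_right]; ring
  have hnn : ∀ r ∈ Set.Ioo a 1, 0 ≤ r * ((α + 1) * (1 - r ^ 2) ^ α) := by
    intro r hr
    have := hpos r hr
    have : 0 ≤ r := ha0.trans hr.1.le
    positivity
  -- Integrability up to `r = 1` comes from the sign of the integrand and the continuity of its
  -- primitive `G`.
  have hint := intervalIntegral.integrableOn_deriv_of_nonneg hcont hderiv hnn
  have hval := intervalIntegral.integral_eq_sub_of_hasDerivAt_of_le ha1 hcont hderiv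
    ((intervalIntegrable_iff_integrableOn_Ioc_of_le ha1).2 hint)
  rw [intervalIntegral.integral_of_le ha1, integral_Ioc_eq_integral_Ioo] at hval
  rw [← ofReal_integral_eq_lintegral_ofReal (hint.mono_set Set.Ioo_subset_Ioc_self)
    ((ae_restrict_iff' measurableSet_Ioo).2 (Filter.Eventually.of_forall hnn)), hval]
  congr 1
  simp [hG, ha2, Real.zero_rpow hα1.ne']

/-- In polar coordinates: a set contained in the annulus `1 - ‖z‖ ^ 2 < ε`, whose circular slices have
angular measure at most `M`, has weighted area at most `ε ^ (α + 1) / 2 * M`. -/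
theorem setLIntegral_density_le {α ε : ℝ} (hα : -1 < α) (hε : 0 ≤ ε) (hε1 : ε ≤ 1) {S : Set ℂ}
    (hS : MeasurableSet S) {M : ENNReal} (hSε : ∀ z ∈ S, z ∈ disk ∧ 1 - ‖z‖ ^ 2 < ε)
    (hM : ∀ r : ℝ, 0 < r → r < 1 → 1 - r ^ 2 < ε →
      volume (Set.Ioo (-Real.pi) Real.pi ∩ {θ : ℝ | circleMap 0 r θ ∈ S}) ≤ M) :
    ∫⁻ z in S, density α z ≤ ENNReal.ofReal (ε ^ (α + 1) / 2) * M := by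
  have hsymm : ∀ r θ : ℝ, Complex.polarCoord.symm (r, θ) = circleMap 0 r θ := by
    intro r θ
    simp [circleMap, Complex.exp_mul_I]
  have hk : Measurable (S.indicator (density α)) := (measurable_density α).indicator hS
  have hcm : Measurable fun p : ℝ × ℝ => circleMap 0 p.1 p.2 := by
    unfold circleMap; fun_prop
  have hinner : ∀ r ∈ Set.Ioi (0 : ℝ),
      ∫⁻ θ in Set.Ioo (-Real.pi) Real.pi,
        ENNReal.ofReal r * S.indicator (density α) (circleMap 0 r θ) ≤
      (Set.Ioo (√(1 - ε)) 1).indicator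
        (fun r => ENNReal.ofReal (r * ((α + 1) * (1 - r ^ 2) ^ α))) r * M := by
    intro r hr
    have hr0 : 0 < r := hr
    have hnorm : ∀ θ, ‖circleMap 0 r θ‖ = r := fun θ => by simp [abs_of_pos hr0]
    by_cases hmem : r ∈ Set.Ioo (√(1 - ε)) 1
    · have hr2 : 1 - r ^ 2 < ε := by
        have := (Real.sqrt_lt' hr0).1 hmem.1; linarith
      rw [Set.indicator_of_mem hmem]
      have hmeas : MeasurableSet {θ : ℝ | circleMap 0 r θ ∈ S} :=
        (continuous_circleMap 0 r).measurable hS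
      have e : ∀ θ, ENNReal.ofReal r * S.indicator (density α) (circleMap 0 r θ) =
          {θ : ℝ | circleMap 0 r θ ∈ S}.indicator
            (fun _ => ENNReal.ofReal (r * ((α + 1) * (1 - r ^ 2) ^ α))) θ := by
        intro θ
        by_cases hθ : circleMap 0 r θ ∈ S
        · rw [Set.indicator_of_mem hθ, Set.indicator_of_mem (by exact hθ), density, hnorm,
            ← ENNReal.ofReal_mul hr0.le]
        · rw [Set.indicator_of_notMem hθ, Set.indicator_of_notMem (by exact hθ), mul_zero]
      simp_rw [e]
      rw [lintegral_indicator_const hmeas, Measure.restrict_apply hmeas, Set.inter_comm]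
      gcongr
      exact hM r hr0 hmem.2 hr2
    · refine le_of_eq_of_le ?_ zero_le
      rw [lintegral_eq_zero_iff (by fun_prop)]
      refine Filter.Eventually.of_forall fun θ => ?_
      have hθ : circleMap 0 r θ ∉ S := by
        intro hθ
        obtain ⟨h1, h2⟩ := hSε _ hθ
        rw [hnorm] at h2
        have h1' : ‖circleMap 0 r θ‖ < 1 := h1
        rw [hnorm] at h1'
        exact hmem ⟨(Real.sqrt_lt' hr0).2 (by linarith), h1'⟩
      simp [Set.indicator_of_notMem hθ]
  calc ∫⁻ z in S, density α z = ∫⁻ z, S.indicator (density α) z := (lintegral_indicator hS _).symm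
    _ = ∫⁻ p in Set.Ioi (0 : ℝ) ×ˢ Set.Ioo (-Real.pi) Real.pi,
          ENNReal.ofReal p.1 * S.indicator (density α) (circleMap 0 p.1 p.2) := by
        rw [← Complex.lintegral_comp_polarCoord_symm, polarCoord_target]
        refine lintegral_congr fun p => ?_
        rw [smul_eq_mul, ← hsymm]
    _ = ∫⁻ r in Set.Ioi (0 : ℝ), ∫⁻ θ in Set.Ioo (-Real.pi) Real.pi,
          ENNReal.ofReal r * S.indicator (density α) (circleMap 0 r θ) := by
        rw [Measure.volume_eq_prod, ← Measure.prod_restrict, lintegral_prod]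
        exact ((by fun_prop : Measurable fun p : ℝ × ℝ => ENNReal.ofReal p.1).mul
          (hk.comp hcm)).aemeasurable
    _ ≤ ∫⁻ r in Set.Ioi (0 : ℝ), (Set.Ioo (√(1 - ε)) 1).indicator
          (fun r => ENNReal.ofReal (r * ((α + 1) * (1 - r ^ 2) ^ α))) r * M :=
        setLIntegral_mono' measurableSet_Ioi hinner
    _ ≤ ∫⁻ r, (Set.Ioo (√(1 - ε)) 1).indicator
          (fun r => ENNReal.ofReal (r * ((α + 1) * (1 - r ^ 2) ^ α))) r * M :=
        setLIntegral_le_lintegral _ _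
    _ = ENNReal.ofReal (ε ^ (α + 1) / 2) * M := by
        rw [lintegral_mul_const _ ((by fun_prop : Measurable fun r : ℝ =>
          ENNReal.ofReal (r * ((α + 1) * (1 - r ^ 2) ^ α))).indicator measurableSet_Ioo),
          lintegral_indicator measurableSet_Ioo, lintegral_radial_density hα hε hε1]

/-! ### From the local to the global estimate -/

theorem isOpen_disk : IsOpen disk := disk_eq_ball ▸ Metric.isOpen_ball

theorem isOpen_setOf_norm_mem {g : ℂ → ℂ} (hg : ContinuousOn g disk) {s : Set ℝ} (hs : IsOpen s) :
    IsOpen {z | z ∈ disk ∧ ‖g z‖ ∈ s} :=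
  hg.norm.isOpen_inter_preimage isOpen_disk hs

/-- The local estimate: if `‖g w‖ ≤ 25`, the part of `{l < ‖g‖}` near `w` has weighted area
`O(((1 - ‖w‖ ^ 2) / l) ^ (α + 2))`. One factor `(1 - ‖w‖ ^ 2) / l` is the measure of the circular
slices, the other `α + 1` come from the width of the annulus which contains this set. -/
theorem setLIntegral_density_near_le {α l : ℝ} (hα : -1 < α) (hl : 1800 ≤ l) {g : ℂ → ℂ}
    (hg : AnalyticOnNhd ℂ g disk) (hmaps : Set.MapsTo g disk rightHalfPlane) {w : ℂ}
    (hw : w ∈ disk) (hgw : ‖g w‖ ≤ 25) :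
    ∫⁻ z in {z | z ∈ disk ∧ l < ‖g z‖} ∩ {z | ‖z - w‖ ≤ 2 * (1 - ‖w‖ ^ 2)}, density α z ≤
      ENNReal.ofReal (400 * Real.pi * 900 ^ (α + 1) * ((1 - ‖w‖ ^ 2) / l) ^ (α + 2)) := by
  have hl0 : 0 < l := by linarith
  have hwδ := one_sub_norm_sq_pos hw
  have hwδ1 : 1 - ‖w‖ ^ 2 ≤ 1 := by nlinarith [norm_nonneg w]
  have hE : MeasurableSet {z | z ∈ disk ∧ l < ‖g z‖} :=
    (isOpen_setOf_norm_mem hg.continuousOn isOpen_Ioi).measurableSet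
  have hT : MeasurableSet {z : ℂ | ‖z - w‖ ≤ 2 * (1 - ‖w‖ ^ 2)} :=
    measurableSet_le (by fun_prop) (by fun_prop)
  set q := (1 - ‖w‖ ^ 2) / l with hq
  have hq0 : 0 < q := by positivity
  have hql : q * 1800 ≤ 1 - ‖w‖ ^ 2 := by
    rw [hq, div_mul_eq_mul_div, div_le_iff₀ hl0]; gcongr
  -- `900 = 36 * 25` and `800 = 32 * 25`, from the two estimates at `w`; `l ≥ 1800` makes the width
  -- `900 * q` of the annulus at most `(1 - ‖w‖ ^ 2) / 2`.
  refine (setLIntegral_density_le hα (ε := 900 * q) (M := ENNReal.ofReal (800 * Real.pi * q))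
    (by positivity) (by linarith) (hE.inter hT) ?_ ?_).trans (le_of_eq ?_)
  · rintro z ⟨⟨hz, hgz⟩, hzw⟩
    refine ⟨hz, ?_⟩
    have h1 := norm_mul_one_sub_norm_sq_le_of_near hg.differentiableOn hmaps hw hz hzw
    have h2 := mul_lt_mul_of_pos_right hgz (one_sub_norm_sq_pos hz)
    have h3 := mul_le_mul_of_nonneg_right hgw hwδ.le
    rw [hq, mul_div_assoc', lt_div_iff₀ hl0]
    linarith
  · intro r hr hr1 hrε
    refine (measure_mono ?_).trans ((volume_arc_le hg hmaps hw hl0 hr hr1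
      (by linarith)).trans (ENNReal.ofReal_le_ofReal ?_))
    · rintro θ ⟨hθ, ⟨-, h1⟩, h2⟩
      exact ⟨hθ, h2, h1⟩
    · rw [hq, mul_div_assoc']
      refine div_le_div_of_nonneg_right (mul_le_mul_of_nonneg_right ?_ hwδ.le) hl0.le
      linarith [mul_le_mul_of_nonneg_left hgw Real.pi_pos.le]
  · rw [← ENNReal.ofReal_mul (by positivity)]
    congr 1
    rw [Real.mul_rpow (by norm_num) hq0.le, show α + 2 = α + 1 + 1 by ring,
      Real.rpow_add_one hq0.ne' (α + 1)]
    ring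

/-- The point `v` lies on the segment from `0` to `z`, whence `‖z - v‖ = ‖z‖ - ‖v‖`. -/
theorem exists_norm_eq_on_radius {g : ℂ → ℂ} (hg : ContinuousOn g disk) {z : ℂ} (hz : z ∈ disk)
    {m : ℝ} (h0 : ‖g 0‖ ≤ m) (hm : m ≤ ‖g z‖) :
    ∃ v ∈ disk, ‖g v‖ = m ∧ ‖z - v‖ ≤ 1 - ‖v‖ := by
  have hz1 : ‖z‖ < 1 := hz
  have hnorm : ∀ t ∈ Set.Icc (0 : ℝ) 1, ‖(t : ℂ) * z‖ = t * ‖z‖ := fun t ht => by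
    rw [norm_mul, Complex.norm_real, Real.norm_of_nonneg ht.1]
  have hmem : ∀ t ∈ Set.Icc (0 : ℝ) 1, (t : ℂ) * z ∈ disk := by
    intro t ht
    change ‖(t : ℂ) * z‖ < 1
    rw [hnorm t ht]
    nlinarith [ht.1, ht.2, norm_nonneg z]
  have hc : ContinuousOn (fun t : ℝ => ‖g (t * z)‖) (Set.Icc 0 1) :=
    (hg.comp (by fun_prop) hmem).norm
  obtain ⟨t, ht, hgt⟩ := intermediate_value_Icc zero_le_one hc (show m ∈ _ by simpa using ⟨h0, hm⟩)
  refine ⟨t * z, hmem t ht, hgt, ?_⟩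
  have e : z - t * z = ((1 - t : ℝ) : ℂ) * z := by push_cast; ring
  rw [hnorm t ht, e, norm_mul, Complex.norm_real, Real.norm_of_nonneg (by linarith [ht.2])]
  linarith

/-- Every point `z` with `l < ‖g z‖` lies near a substantial set of points `w` at which
`1 < ‖g w‖ < 25`: this set has invariant measure `∫ dx dy / (1 - ‖w‖ ^ 2) ^ 2` at least `π / 100`. -/
theorem le_setLIntegral_near {l : ℝ} (hl : 1800 ≤ l) {g : ℂ → ℂ}
    (hg : AnalyticOnNhd ℂ g disk) (hmaps : Set.MapsTo g disk rightHalfPlane) (h0 : ‖g 0‖ ≤ 1)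
    {z : ℂ} (hz : z ∈ disk) (hgz : l < ‖g z‖) :
    ENNReal.ofReal (Real.pi / 100) ≤
      ∫⁻ w in {w | w ∈ disk ∧ ‖g w‖ ∈ Set.Ioo 1 25}, {w : ℂ | ‖z - w‖ ≤ 2 * (1 - ‖w‖ ^ 2)}.indicator
        (fun w => ENNReal.ofReal ((1 - ‖w‖ ^ 2) ^ 2)⁻¹) w := by
  -- By the Harnack inequality the ball around `v` of radius `(1 - ‖v‖) / 4` consists of such points.
  obtain ⟨v, hv, hgv, hzv⟩ := exists_norm_eq_on_radius hg.continuousOn hz (m := 10)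
    (by linarith) (by linarith)
  have hv1 : ‖v‖ < 1 := hv
  set R := 1 - ‖v‖ with hR
  have hR0 : 0 < R := by linarith
  have hball : Metric.ball v R ⊆ disk := by
    rw [disk_eq_ball]
    exact Metric.ball_subset_ball' (by simp [hR])
  have hT : MeasurableSet {w : ℂ | ‖z - w‖ ≤ 2 * (1 - ‖w‖ ^ 2)} :=
    measurableSet_le (by fun_prop) (by fun_prop)
  have hfacts : ∀ w ∈ Metric.ball v (R / 4), w ∈ disk ∧ ‖g w‖ ∈ Set.Ioo 1 25 ∧
      ‖z - w‖ ≤ 2 * (1 - ‖w‖ ^ 2) ∧ 0 < 1 - ‖w‖ ^ 2 ∧ 1 - ‖w‖ ^ 2 ≤ 5 / 2 * R := by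
    intro w hw
    have hwR : w ∈ Metric.ball v R := Metric.ball_subset_ball (by linarith) hw
    have hd : dist w v < R / 4 := hw
    have hd0 : 0 ≤ dist w v := dist_nonneg
    have hwd := hball hwR
    have hw1 : ‖w‖ < 1 := hwd
    obtain ⟨h1, h2⟩ := harnack_of_mapsTo_rightHalfPlane (hg.differentiableOn.mono hball)
      (hmaps.mono_left hball) hwR
    rw [hgv] at h1 h2
    have h3 : ‖z - w‖ ≤ ‖z - v‖ + ‖w - v‖ := by
      rw [norm_sub_rev w v]; exact norm_sub_le_norm_sub_add_norm_sub _ _ _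
    have h4 : ‖w‖ ≤ ‖v‖ + ‖w - v‖ := by simpa using norm_add_le v (w - v)
    have h5 : ‖v‖ ≤ ‖w‖ + ‖w - v‖ := by
      rw [norm_sub_rev]; simpa using norm_add_le w (v - w)
    rw [dist_eq_norm] at *
    refine ⟨hwd, ⟨?_, ?_⟩, ?_, one_sub_norm_sq_pos hwd, ?_⟩
    · by_contra! hcon
      nlinarith
    · by_contra! hcon
      nlinarith
    · nlinarith [norm_nonneg w]
    · nlinarith [norm_nonneg w]
  rw [setLIntegral_indicator hT]
  calc ENNReal.ofReal (Real.pi / 100)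
      = ∫⁻ _ in Metric.ball v (R / 4), ENNReal.ofReal ((5 / 2 * R) ^ 2)⁻¹ := by
        rw [setLIntegral_const, Complex.volume_ball, ← ENNReal.ofReal_pow (by positivity),
          show (NNReal.pi : ENNReal) = ENNReal.ofReal Real.pi by
            rw [← NNReal.coe_real_pi, ENNReal.ofReal_coe_nnreal],
          ← ENNReal.ofReal_mul (by positivity), ← ENNReal.ofReal_mul (by positivity)]
        congr 1
        field_simp
        norm_num
    _ ≤ ∫⁻ w in Metric.ball v (R / 4), ENNReal.ofReal ((1 - ‖w‖ ^ 2) ^ 2)⁻¹ := by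
        refine setLIntegral_mono' measurableSet_ball fun w hw => ENNReal.ofReal_le_ofReal ?_
        obtain ⟨-, -, -, h1, h2⟩ := hfacts w hw
        gcongr
    _ ≤ _ := lintegral_mono_set fun w hw => by
        obtain ⟨h1, h2, h3, -, -⟩ := hfacts w hw
        exact ⟨h3, h1, h2⟩

theorem weightedArea_apply (α : ℝ) {S : Set ℂ} (hS : MeasurableSet S) (hSd : S ⊆ disk) :
    weightedArea α S = (ENNReal.ofReal Real.pi)⁻¹ * ∫⁻ z in S, density α z := by
  rw [weightedArea, withDensity_apply _ hS, area, Measure.restrict_smul,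
    Measure.restrict_restrict hS, Set.inter_eq_self_of_subset_left hSd, lintegral_smul_measure,
    smul_eq_mul]
  rfl

/-- The global estimate, by integrating the local one against the invariant measure and exchanging
the order of integration. -/
theorem setLIntegral_density_superlevel_le {α l : ℝ} (hα : -1 < α) (hl : 1800 ≤ l) {g : ℂ → ℂ}
    (hg : AnalyticOnNhd ℂ g disk) (hmaps : Set.MapsTo g disk rightHalfPlane) (h0 : ‖g 0‖ ≤ 1) :
    ENNReal.ofReal (Real.pi / 100) * ∫⁻ z in {z | z ∈ disk ∧ l < ‖g z‖}, density α z ≤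
      ENNReal.ofReal (400 * Real.pi * 900 ^ (α + 1) / (α + 1) / l ^ (α + 2)) *
        ∫⁻ w in {w | w ∈ disk ∧ ‖g w‖ ∈ Set.Ioo 1 25}, density α w := by
  have hl0 : 0 < l := by linarith
  have hα1 : 0 < α + 1 := by linarith
  set E := {z | z ∈ disk ∧ l < ‖g z‖} with hEdef
  set W := {w | w ∈ disk ∧ ‖g w‖ ∈ Set.Ioo 1 25} with hWdef
  have hE : MeasurableSet E := (isOpen_setOf_norm_mem hg.continuousOn isOpen_Ioi).measurableSet
  have hW : MeasurableSet W := (isOpen_setOf_norm_mem hg.continuousOn isOpen_Ioo).measurableSet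
  -- `N` is the relation that `z` is near `w`; `ρ` is the density of the invariant measure in `w`.
  set N : Set (ℂ × ℂ) := {p | ‖p.1 - p.2‖ ≤ 2 * (1 - ‖p.2‖ ^ 2)} with hNdef
  have hN : MeasurableSet N := measurableSet_le (by fun_prop) (by fun_prop)
  set ρ : ℂ → ENNReal := fun w => ENNReal.ofReal ((1 - ‖w‖ ^ 2) ^ 2)⁻¹ with hρ
  have hρm : Measurable ρ := by fun_prop
  have hk := measurable_density α
  set Φ : ℂ × ℂ → ENNReal := N.indicator fun p => density α p.1 * ρ p.2 with hΦ
  have hΦm : Measurable Φ := (by fun_prop : Measurable fun p : ℂ × ℂ =>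
    density α p.1 * ρ p.2).indicator hN
  have hsec1 : ∀ z w, Φ (z, w) = density α z *
      {w : ℂ | ‖z - w‖ ≤ 2 * (1 - ‖w‖ ^ 2)}.indicator ρ w := by
    intro z w
    simp [hΦ, hNdef, Set.indicator]
  have hsec2 : ∀ z w, Φ (z, w) = ρ w *
      {z : ℂ | ‖z - w‖ ≤ 2 * (1 - ‖w‖ ^ 2)}.indicator (density α) z := by
    intro z w
    simp [hΦ, hNdef, Set.indicator, mul_comm]
  calc ENNReal.ofReal (Real.pi / 100) * ∫⁻ z in E, density α z
      = ∫⁻ z in E, density α z * ENNReal.ofReal (Real.pi / 100) := by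
        rw [lintegral_mul_const _ hk, mul_comm]
    _ ≤ ∫⁻ z in E, ∫⁻ w in W, Φ (z, w) := by
        refine setLIntegral_mono' hE fun z hz => ?_
        simp_rw [hsec1]
        rw [lintegral_const_mul _ (hρm.indicator (measurableSet_le (by fun_prop) (by fun_prop)))]
        gcongr
        exact le_setLIntegral_near hl hg hmaps h0 hz.1 hz.2
    _ = ∫⁻ w in W, ∫⁻ z in E, Φ (z, w) := lintegral_lintegral_swap hΦm.aemeasurable
    _ ≤ ∫⁻ w in W, ENNReal.ofReal (400 * Real.pi * 900 ^ (α + 1) / (α + 1) / l ^ (α + 2)) *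
          density α w := by
        refine setLIntegral_mono' hW fun w hw => ?_
        have hT : MeasurableSet {z : ℂ | ‖z - w‖ ≤ 2 * (1 - ‖w‖ ^ 2)} :=
          measurableSet_le (by fun_prop) (by fun_prop)
        have hδ := one_sub_norm_sq_pos hw.1
        simp_rw [hsec2]
        rw [lintegral_const_mul _ (hk.indicator hT), setLIntegral_indicator hT, Set.inter_comm]
        calc _ ≤ ρ w * ENNReal.ofReal
              (400 * Real.pi * 900 ^ (α + 1) * ((1 - ‖w‖ ^ 2) / l) ^ (α + 2)) := by
              gcongr
              exact setLIntegral_density_near_le hα hl hg hmaps hw.1 hw.2.2.le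
          _ = _ := by
              rw [hρ, density, ← ENNReal.ofReal_mul (by positivity),
                ← ENNReal.ofReal_mul (by positivity), Real.div_rpow hδ.le hl0.le,
                Real.rpow_add hδ α 2, Real.rpow_two]
              congr 1
              field_simp
    _ = _ := lintegral_const_mul _ hk

end WeightedBergman

theorem mainTheorem3 (α : ℝ) (hα : -1 < α) :
    ∃ K₀ c₀ l₀ : ℝ, 0 < K₀ ∧ 0 < c₀ ∧ 1 < l₀ ∧
      ∀ g : ℂ → ℂ, AnalyticOnNhd ℂ g WeightedBergman.disk →
        Set.MapsTo g WeightedBergman.disk WeightedBergman.rightHalfPlane →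
        ‖g 0‖ ≤ c₀ →
        ∀ l : ℝ, l₀ ≤ l →
          WeightedBergman.weightedArea α {z | z ∈ WeightedBergman.disk ∧ l < ‖g z‖} ≤
            ENNReal.ofReal (K₀ / l ^ (α + 2)) *
              WeightedBergman.weightedArea α {z | z ∈ WeightedBergman.disk ∧ 1 < ‖g z‖} := by
  have hα1 : 0 < α + 1 := by linarith
  refine ⟨40000 * 900 ^ (α + 1) / (α + 1), 1, 1800, by positivity, one_pos, by norm_num, ?_⟩
  intro g hg hmaps h0 l hl
  have hl0 : 0 < l := by linarith
  have hmeas : ∀ m : ℝ, MeasurableSet {z | z ∈ WeightedBergman.disk ∧ m < ‖g z‖} := fun m =>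
    (WeightedBergman.isOpen_setOf_norm_mem hg.continuousOn isOpen_Ioi).measurableSet
  rw [WeightedBergman.weightedArea_apply α (hmeas l) fun z hz => hz.1,
    WeightedBergman.weightedArea_apply α (hmeas 1) fun z hz => hz.1, mul_left_comm]
  gcongr
  have key := WeightedBergman.setLIntegral_density_superlevel_le hα hl hg hmaps h0
  have hπ : ENNReal.ofReal (100 / Real.pi) * ENNReal.ofReal (Real.pi / 100) = 1 := by
    rw [← ENNReal.ofReal_mul (by positivity), ← ENNReal.ofReal_one]
    congr 1
    field_simp
  calc _ = ENNReal.ofReal (100 / Real.pi) * (ENNReal.ofReal (Real.pi / 100) *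
          ∫⁻ z in {z | z ∈ WeightedBergman.disk ∧ l < ‖g z‖}, WeightedBergman.density α z) := by
        rw [← mul_assoc, hπ, one_mul]
    _ ≤ _ := mul_le_mul_right key _
    _ = ENNReal.ofReal (40000 * 900 ^ (α + 1) / (α + 1) / l ^ (α + 2)) *
          ∫⁻ w in {w | w ∈ WeightedBergman.disk ∧ ‖g w‖ ∈ Set.Ioo 1 25},
            WeightedBergman.density α w := by
        rw [← mul_assoc, ← ENNReal.ofReal_mul (by positivity)]
        congr 2
        field_simp
        norm_num
    _ ≤ _ := by
        gcongr
        exact fun hw => hw.1
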